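/- Let $K$ be a noetherian commutative ring with unity and let $c \ge 1$ be an integer. Let $\mathrm{FI}$ be the category of finite sets and injections, and $\mathrm{FI}^O$ the category of totally ordered finite sets and order-preserving injections; write $[n] = \{1,\dots,n\}$. For $\mathcal C \in \{\mathrm{FI}, \mathrm{FI}^O\}$, a *$\mathcal C$-algebra* over $K$ is a functor $\mathbf A$ from $\mathcal C$ to commutative unital $K$-algebras with $\mathbf A(\emptyset) = K$. A *$\mathcal C$-module* over $\mathbf A$ is a functor $\mathbf M$ from $\mathcal C$ to $K$-modules such that each $\mathbf M_S = \mathbf M(S)$ is an $\mathbf A_S$-module (compatibly with its $K$-module structure) and $\mathbf M(\varepsilon)(\mathbf A(\tilde\varepsilon)(a) \cdot q) = \mathbf A(\varepsilon \circ \tilde\varepsilon)(a) \cdot \mathbf M(\varepsilon)(q)$ for all morphisms $\tilde\varepsilon \colon \tilde S \to S$, $\varepsilon \colon S \to T$ and all $a \in \mathbf A_{\tilde S}$, $q \in \mathbf M_S$. A *submodule* $\mathbf N$ of $\mathbf M$ is a family of $\mathbf A_S$-submodules $\mathbf N_S \subseteq \mathbf M_S$ with $\mathbf M(\varepsilon)(\mathbf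 N_S) \subseteq \mathbf N_T$ for every $\varepsilon \colon S \to T$. A module $\mathbf M$ is *finitely generated* if some finite subset of $\coprod_{n \ge 0} \mathbf M_{[n]}$ is not contained in any proper submodule of $\mathbf M$, and it is *noetherian* if all its submodules are finitely generated. Let $\mathbf X^{O,1}$ be the $\mathrm{FI}^O$-algebra with $\mathbf X^{O,1}_S = K[x_\pi : \pi \in \mathrm{Hom}_{\mathrm{FI}^O}([1],S)]$ and $\varepsilon \colon S \to T$ acting by $x_\pi \mapsto x_{\varepsilon\circ\pi}$; let $\mathbf X^{I,1}$ be the $\mathrm{FI}$-algebra defined in the same way with $\mathrm{FI}$ in place of $\mathrm{FI}^O$. Let $(-)^{\otimes c}$ denote the $c$-fold tensor power over $K$, formed objectwise. Let $\mathbf P$ be the $\mathrm{FI}^O$-algebra with $\mathbf P_S = K[x_{i,j} : i \in [c],\ j \in S]$ and $\varepsilon$ acting by $x_{i,j} \mapsto x_{i,\varepsilon(j)}$. **Theorem.** (i) The $\mathrm{FI}^O$-algebras $\mathbf P$ and $(\mathbf X^{O,1})^{\otimes c}$ are isomorphic, and every finitely generated $\mathrm{FI}^O$-module over an $\mathrm{FI}^O$-algebra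 isomorphic to $(\mathbf X^{O,1})^{\otimes c}$ (in particular, over $\mathbf P$) is noetherian. (ii) Every finitely generated $\mathrm{FI}$-module over an $\mathrm{FI}$-algebra isomorphic to $(\mathbf X^{I,1})^{\otimes c}$ is noetherian. -/

import Mathlib

open CategoryTheory

open scoped TensorProduct

universe v u

/-! ### The categories of finite sets -/

/-- The category `FI`: objects are finite sets. -/
structure FI where
  carrier : Type
  [finite : Finite carrier]

/-- The category `FI^O` (also called `OI`): objects are totally ordered finite sets. -/
structure OI where
  carrier : Type
  [linearOrder : LinearOrder carrier]
  [finite : Finite carrier]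

namespace FI

instance : CoeSort FI Type := ⟨FI.carrier⟩

attribute [instance] FI.finite

/-- The morphisms of `FI` are the injective maps. -/
instance : Category FI where
  Hom S T := S ↪ T
  id S := Function.Embedding.refl S
  comp f g := f.trans g

end FI

namespace OI

instance : CoeSort OI Type := ⟨OI.carrier⟩

attribute [instance] OI.linearOrder OI.finite

/-- The morphisms of `FI^O` are the order-preserving injective maps. -/
instance : Category OI where
  Hom S T := S ↪o T
  id S := RelEmbedding.refl _
  comp f g := RelEmbedding.trans f g

end OI

/-- A category with objects `[0], [1], [2], …`; this serves to treat `FI` and `FI^O` uniformly. The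
only instances are the two below, where `[n]` is the standard (ordered) set with `n` elements. -/
class StdObjects (C : Type*) [Category C] where
  std : ℕ → C
  isEmpty_hom : ∀ d : ℕ, d ≠ 0 → IsEmpty (std d ⟶ std 0)

instance : StdObjects FI where
  std n := ⟨Fin n⟩
  isEmpty_hom d hd := ⟨fun f : Fin d ↪ Fin 0 => (f ⟨0, Nat.pos_of_ne_zero hd⟩).elim0⟩

instance : StdObjects OI where
  std n := ⟨Fin n⟩
  isEmpty_hom d hd := ⟨fun f : Fin d ↪o Fin 0 => (f ⟨0, Nat.pos_of_ne_zero hd⟩).elim0⟩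

/-! ### Algebras -/

/-- A `C`-algebra over `K`, for `C` one of `FI` and `FI^O`: a functor `A` from `C` to commutative
`K`-algebras such that `A(∅) = K`, that is, the structure map `K → A(∅)` is an isomorphism. -/
structure CatAlgebra (C : Type*) [Category C] [StdObjects C] (K : Type u) [CommRing K] where
  functor : C ⥤ CommAlgCat.{u} K
  bijective_algebraMap : Function.Bijective
    (algebraMap K (functor.obj (StdObjects.std 0 : C)))

/-- `FI`-algebras over `K`. -/
abbrev FIAlgebra (K : Type u) [CommRing K] := CatAlgebra FI K

/-- `FI^O`-algebras over `K`. -/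
abbrev OIAlgebra (K : Type u) [CommRing K] := CatAlgebra OI K

namespace CatAlgebra

theorem bijective_algebraMap_mvPolynomial (σ : Type*) [IsEmpty σ] (K : Type*) [CommRing K] :
    Function.Bijective (algebraMap K (MvPolynomial σ K)) :=
  ⟨MvPolynomial.C_injective σ K, MvPolynomial.C_surjective σ⟩

section Poly

variable (C : Type*) [Category.{0} C] [StdObjects C] (K : Type u) [CommRing K]

/-- The algebra `X^d` for `d ≥ 1`: `(X^d)_S = K[x_π : π ∈ Hom([d], S)]`, and `ε : S ⟶ T` acts by
`x_π ↦ x_{ε ∘ π}`. -/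
noncomputable def poly (d : ℕ) [NeZero d] : CatAlgebra C K where
  functor :=
    { obj := fun S => CommAlgCat.of K (MvPolynomial ((StdObjects.std d : C) ⟶ S) K)
      map := fun ε => CommAlgCat.ofHom (MvPolynomial.rename fun π => π ≫ ε)
      map_id := fun S => by
        ext π
        simp
      map_comp := fun ε δ => by
        ext π
        simp }
  bijective_algebraMap :=
    haveI := StdObjects.isEmpty_hom (C := C) d (NeZero.ne d)
    bijective_algebraMap_mvPolynomial _ K

end Poly

section Tensor

variable {ι : Type} {K : Type u} [CommRing K]

/-- The tensor product over `K` of a finite family of homomorphisms of `K`-algebras. -/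
noncomputable def tensorMap {A B : ι → Type u} [∀ i, CommRing (A i)] [∀ i, Algebra K (A i)]
    [∀ i, CommRing (B i)] [∀ i, Algebra K (B i)] (f : ∀ i, A i →ₐ[K] B i) :
    (⨂[K] i, A i) →ₐ[K] ⨂[K] i, B i :=
  PiTensorProduct.liftAlgHom
    ((PiTensorProduct.tprod K).compLinearMap fun i => (f i).toLinearMap)
    (by
      simp only [MultilinearMap.compLinearMap_apply, PiTensorProduct.one_def]
      congr 1; ext i; simp)
    (fun x y => by
      simp only [MultilinearMap.compLinearMap_apply, PiTensorProduct.tprod_mul_tprod]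
      congr 1; ext i; simp)

@[simp] theorem tensorMap_tprod {A B : ι → Type u} [∀ i, CommRing (A i)] [∀ i, Algebra K (A i)]
    [∀ i, CommRing (B i)] [∀ i, Algebra K (B i)] (f : ∀ i, A i →ₐ[K] B i) (x : ∀ i, A i) :
    tensorMap f (PiTensorProduct.tprod K x) = PiTensorProduct.tprod K fun i => f i (x i) :=
  PiTensorProduct.lift.tprod x

theorem tensor_algHom_ext {A : ι → Type u} [∀ i, CommRing (A i)] [∀ i, Algebra K (A i)]
    {B : Type u} [CommRing B] [Algebra K B] {f g : (⨂[K] i, A i) →ₐ[K] B}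
    (h : ∀ x : ∀ i, A i, f (PiTensorProduct.tprod K x) = g (PiTensorProduct.tprod K x)) :
    f = g :=
  AlgHom.toLinearMap_injective (PiTensorProduct.ext (MultilinearMap.ext h))

theorem tensorMap_id (A : ι → Type u) [∀ i, CommRing (A i)] [∀ i, Algebra K (A i)] :
    tensorMap (fun i => AlgHom.id K (A i)) = AlgHom.id K _ :=
  tensor_algHom_ext fun x => by simp

theorem tensorMap_comp {A B D : ι → Type u} [∀ i, CommRing (A i)] [∀ i, Algebra K (A i)]
    [∀ i, CommRing (B i)] [∀ i, Algebra K (B i)] [∀ i, CommRing (D i)] [∀ i, Algebra K (D i)]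
    (f : ∀ i, A i →ₐ[K] B i) (g : ∀ i, B i →ₐ[K] D i) :
    tensorMap (fun i => (g i).comp (f i)) = (tensorMap g).comp (tensorMap f) :=
  tensor_algHom_ext fun x => by simp

theorem bijective_algebraMap_tensor [Fintype ι] (A : ι → Type u) [∀ i, CommRing (A i)]
    [∀ i, Algebra K (A i)] (h : ∀ i, Function.Bijective (algebraMap K (A i))) :
    Function.Bijective (algebraMap K (⨂[K] i, A i)) := by
  classical
  let e : ∀ i, K ≃ₐ[K] A i := fun i => AlgEquiv.ofBijective (Algebra.ofId K (A i)) (h i)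
  let E : (⨂[K] _ : ι, K) ≃ₐ[K] ⨂[K] i, A i :=
    AlgEquiv.ofAlgHom (tensorMap fun i => (e i).toAlgHom)
      (tensorMap fun i => (e i).symm.toAlgHom)
      (tensor_algHom_ext fun x => by simp) (tensor_algHom_ext fun x => by simp)
  let F : K ≃ₐ[K] ⨂[K] i, A i := (PiTensorProduct.constantBaseRingEquiv ι K).symm.trans E
  have hF : ∀ k, algebraMap K (⨂[K] i, A i) k = F k := fun k => (F.commutes k).symm
  rw [show ⇑(algebraMap K (⨂[K] i, A i)) = F from funext hF]
  exact F.bijective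

/-- The tensor product over `K` of a finite family of algebras, formed objectwise:
`(⨂ A_i)_S = ⨂ (A_i)_S`. -/
noncomputable def tensor [Fintype ι] {C : Type*} [Category C] [StdObjects C]
    (A : ι → CatAlgebra C K) :
    CatAlgebra C K where
  functor :=
    { obj := fun S => CommAlgCat.of K (⨂[K] i, (A i).functor.obj S)
      map := fun ε => CommAlgCat.ofHom (tensorMap fun i => ((A i).functor.map ε).hom)
      map_id := fun S => by
        ext1
        simpa using tensorMap_id (K := K) fun i => (A i).functor.obj S
      map_comp := fun {S T U} ε δ => by
        ext1
        simpa using tensorMap_comp (fun i => ((A i).functor.map ε).hom)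
          (fun i => ((A i).functor.map δ).hom) }
  bijective_algebraMap := bijective_algebraMap_tensor _ fun i => (A i).bijective_algebraMap

/-- The tensor power `A^{⊗ c}`. -/
noncomputable def tensorPow {C : Type*} [Category C] [StdObjects C] (A : CatAlgebra C K) (c : ℕ) :
    CatAlgebra C K :=
  tensor fun _ : Fin c => A

end Tensor

end CatAlgebra

/-- The `FI^O`-algebra `X^{O,d}`, for `d ≥ 1`. -/
noncomputable abbrev XO (K : Type u) [CommRing K] (d : ℕ) [NeZero d] : OIAlgebra K :=
  CatAlgebra.poly OI K d

/-- The `FI`-algebra `X^{I,d}`, for `d ≥ 1`. -/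
noncomputable abbrev XI (K : Type u) [CommRing K] (d : ℕ) [NeZero d] : FIAlgebra K :=
  CatAlgebra.poly FI K d

/-- The `FI^O`-algebra `P` with `P_S = K[x_{i,j} : i ∈ [c], j ∈ S]` and
`ε^*(x_{i,j}) = x_{i,ε(j)}`. -/
noncomputable def polyP (K : Type u) [CommRing K] (c : ℕ) : OIAlgebra K where
  functor :=
    { obj := fun S => CommAlgCat.of K (MvPolynomial (Fin c × S) K)
      map := fun {S T} (ε : S ↪o T) =>
        CommAlgCat.ofHom (MvPolynomial.rename fun ij => (ij.1, ε ij.2))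
      map_id := fun S => by
        ext1
        exact MvPolynomial.algHom_ext fun ij => MvPolynomial.rename_X _ _
      map_comp := fun {S T U} (ε : S ↪o T) (δ : T ↪o U) => by
        ext1
        refine MvPolynomial.algHom_ext fun ij => ?_
        change MvPolynomial.rename (R := K) _ (MvPolynomial.X ij) =
          MvPolynomial.rename _ (MvPolynomial.rename _ (MvPolynomial.X ij))
        simp only [MvPolynomial.rename_X]
        rfl }
  bijective_algebraMap :=
    haveI : IsEmpty (Fin c × (StdObjects.std 0 : OI)) := ⟨fun ij => (ij.2 : Fin 0).elim0⟩
    CatAlgebra.bijective_algebraMap_mvPolynomial _ K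

/-! ### Modules -/

section Modules

variable {C : Type*} [Category C] [StdObjects C] {K : Type u} [CommRing K]

/-- A `C`-module over the `C`-algebra `A`: a functor `M` from `C` to `K`-modules such that each `M_S`
is an `A_S`-module (whose underlying `K`-module is the given one) and, for `δ : S' ⟶ S`,
`ε : S ⟶ T`, `a ∈ A_{S'}` and `q ∈ M_S`, one has `M(ε)(A(δ)(a) q) = A(ε ∘ δ)(a) M(ε)(q)`. -/
structure CatModule (A : CatAlgebra C K) where
  functor : C ⥤ ModuleCat.{v} K
  [module : ∀ S, Module (A.functor.obj S) (functor.obj S)]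
  [isScalarTower : ∀ S, IsScalarTower K (A.functor.obj S) (functor.obj S)]
  map_smul : ∀ {S' S T : C} (δ : S' ⟶ S) (ε : S ⟶ T) (a : A.functor.obj S') (q : functor.obj S),
    functor.map ε (A.functor.map δ a • q) = A.functor.map (δ ≫ ε) a • functor.map ε q

attribute [instance] CatModule.module CatModule.isScalarTower

namespace CatModule

variable {A : CatAlgebra C K}

/-- A submodule of `M`: a family of `A_S`-submodules `N_S ⊆ M_S` with `M(ε)(N_S) ⊆ N_T` for every
`ε : S ⟶ T`. -/
structure Sub (M : CatModule.{v} A) where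
  obj : ∀ S : C, Submodule (A.functor.obj S) (M.functor.obj S)
  map_mem : ∀ {S T : C} (ε : S ⟶ T) {q : M.functor.obj S}, q ∈ obj S → M.functor.map ε q ∈ obj T

/-- `M` as a submodule of itself. -/
def Sub.whole (M : CatModule.{v} A) : M.Sub where
  obj _ := ⊤
  map_mem _ _ _ := Submodule.mem_top

/-- The disjoint union `∐_{n ≥ 0} M_n`, where `M_n = M([n])`. -/
abbrev Elements (M : CatModule.{v} A) : Type v :=
  Σ n : ℕ, M.functor.obj (StdObjects.std n : C)

/-- A set `G ⊆ ∐_n M_n` is contained in the submodule `N`. -/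
def Sub.Contains {M : CatModule.{v} A} (N : M.Sub) (G : Set M.Elements) : Prop :=
  ∀ g ∈ G, g.2 ∈ N.obj (StdObjects.std g.1 : C)

/-- A submodule `N` of `M` is finitely generated if there is a finite subset of `∐_n N_n` which is
not contained in any proper submodule of `N`. -/
def Sub.FinitelyGenerated {M : CatModule.{v} A} (N : M.Sub) : Prop :=
  ∃ G : Set M.Elements, G.Finite ∧ N.Contains G ∧
    ∀ N' : M.Sub, (∀ S, N'.obj S ≤ N.obj S) → N'.Contains G → ∀ S, N'.obj S = N.obj S

/-- A module is finitely generated if it is so as a submodule of itself. -/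
def FinitelyGenerated (M : CatModule.{v} A) : Prop :=
  (Sub.whole M).FinitelyGenerated

/-- A module is noetherian if each of its submodules is finitely generated. -/
def Noetherian (M : CatModule.{v} A) : Prop :=
  ∀ N : M.Sub, N.FinitelyGenerated

end CatModule

end Modules

/-- `FI`-modules over the `FI`-algebra `A`. -/
abbrev FIModule {K : Type u} [CommRing K] (A : FIAlgebra K) := CatModule.{v} A

/-- `FI^O`-modules over the `FI^O`-algebra `A`. -/
abbrev OIModule {K : Type u} [CommRing K] (A : OIAlgebra K) := CatModule.{v} A

/-! ### Well-quasi-orders -/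

namespace WellQuasiOrdered

variable {α β : Type*} {r : α → α → Prop}

/-! This is a Gröbner basis argument. If `M` is finitely generated, each `M_n` is spanned over `K`
by terms: a monomial in the `x_{i,j}` times the image of a generator under an order-preserving
injection. This holds for `FI` too, once each generator of degree `d` is replaced by its finitely
many images under endomorphisms of `[d]`, because an injection is a permutation followed by an
order-preserving injection. Both parts thus become one statement about `OrderedSkeleton` categories.

A term is a generator together with a word whose letters record the exponents at a position and
whether the injection hits it. By the lemmas of Dickson and Higman, divisibility of terms is a
well-quasi-order (`wellQuasiOrdered_divides`). A term is carried to a multiple by an operator `q ↦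
x^v · M(ε) q`, which preserves submodules and the monomial order (`ord_push_lt`).

Terms may be linearly dependent, so `leadIdeal` collects all `a` such that `a • e w` lies in `N`
modulo smaller terms. This ideal grows along divisibility, and `N' ≤ N` are equal once all their
leading ideals agree (`le_of_leadIdeal_le`). As `K` is noetherian, divisibility with equal leading
ideals is still a well-quasi-order; lifting generators of the leading ideals at a finite basis gives
finitely many generators of `N`. -/

theorem exists_finite_basis (hr : WellQuasiOrdered r) :
    ∃ B : Set α, B.Finite ∧ ∀ x, ∃ b ∈ B, r b x := by
  by_contra! h
  obtain ⟨f, -, hf⟩ := exists_seq_of_forall_finset_exists (fun _ : α => True)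
    (fun x y => ¬ r x y) fun s _ => by
      obtain ⟨x, hx⟩ := h s s.finite_toSet
      exact ⟨x, trivial, fun b hb => hx b hb⟩
  obtain ⟨m, n, hmn, h⟩ := hr f
  exact hf m n hmn h

/-- A monotone map from a well-quasi-order to a partial order with the ascending chain condition is
constant on the pairs of a finer well-quasi-order. -/
theorem and_eq_of_monotone [IsPreorder α r] (hr : WellQuasiOrdered r) [PartialOrder β]
    [WellFoundedGT β] (I : α → β) (hI : ∀ x y, r x y → I x ≤ I y) :
    WellQuasiOrdered fun x y => r x y ∧ I x = I y := by
  intro f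
  obtain ⟨g, hg⟩ := hr.exists_monotone_subseq f
  -- Along a monotone subsequence the values of `I` ascend, hence become stationary.
  let F : ℕ →o β := ⟨fun n => I (f (g n)), fun m n hmn => hI _ _ (hg m n hmn)⟩
  obtain ⟨n, hn⟩ := WellFoundedGT.monotone_chain_condition F
  exact ⟨g n, g (n + 1), g.strictMono n.lt_succ_self, hg _ _ n.le_succ, hn _ n.le_succ⟩

end WellQuasiOrdered

/-! ### Spans of well-ordered families -/

section Span

variable {K V W O : Type*} [CommRing K] [AddCommGroup V] [Module K V] [LinearOrder O]

/-- A finite combination has a greatest index. Zero is separate because `s` may be empty. -/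
theorem mem_span_image_Iic_of_mem_span_image (e : W → V) (ord : W → O) {s : Set W} {q : V}
    (hq : q ∈ Submodule.span K (e '' s)) :
    q = 0 ∨ ∃ w ∈ s, q ∈ Submodule.span K (e '' {w' | ord w' ≤ ord w}) := by
  induction hq using Submodule.span_induction with
  | mem x hx =>
    obtain ⟨w, hw, rfl⟩ := hx
    exact .inr ⟨w, hw, Submodule.subset_span ⟨w, le_refl (ord w), rfl⟩⟩
  | zero => exact .inl rfl
  | smul a x _ hx =>
    obtain rfl | ⟨w, hw, hx⟩ := hx
    · exact .inl (smul_zero a)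
    · exact .inr ⟨w, hw, Submodule.smul_mem _ a hx⟩
  | add x y _ _ hx hy =>
    obtain rfl | ⟨w, hw, hx⟩ := hx
    · rwa [zero_add]
    obtain rfl | ⟨w', hw', hy⟩ := hy
    · exact .inr ⟨w, hw, by rwa [add_zero]⟩
    have mono : ∀ {a b : W}, ord a ≤ ord b →
        Submodule.span K (e '' {w' | ord w' ≤ ord a}) ≤
          Submodule.span K (e '' {w' | ord w' ≤ ord b}) :=
      fun h => Submodule.span_mono (Set.image_mono fun _ h' => le_trans h' h)
    rcases le_total (ord w) (ord w') with h | h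
    · exact .inr ⟨w', hw', add_mem (mono h hx) hy⟩
    · exact .inr ⟨w, hw, add_mem hx (mono h hy)⟩

/-- The ideal of the leading coefficients at `w` of the elements of `N`. -/
def leadIdeal (e : W → V) (ord : W → O) (N : Submodule K V) (w : W) : Ideal K :=
  (N ⊔ Submodule.span K (e '' {w' | ord w' < ord w})).comap (LinearMap.toSpanSingleton K V (e w))

theorem mem_leadIdeal {e : W → V} {ord : W → O} {N : Submodule K V} {w : W} {a : K} :
    a ∈ leadIdeal e ord N w ↔
      ∃ q ∈ N, ∃ l ∈ Submodule.span K (e '' {w' | ord w' < ord w}), q + l = a • e w := by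
  rw [leadIdeal, Submodule.mem_comap, Submodule.mem_sup, LinearMap.toSpanSingleton_apply]

/-- Division algorithm: subtracting an element of `N'` with the same leading coefficient leaves an
element of `N` involving only smaller indices, and the order on these is well-founded. -/
theorem le_of_leadIdeal_le [WellFoundedLT O] {e : W → V} {ord : W → O}
    (hord : Function.Injective ord) (he : Submodule.span K (Set.range e) = ⊤)
    {N N' : Submodule K V} (hN : N' ≤ N)
    (h : ∀ w, leadIdeal e ord N w ≤ leadIdeal e ord N' w) : N ≤ N' := by
  have key : ∀ o : O, ∀ w, ord w = o → ∀ q ∈ N,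
      q ∈ Submodule.span K (e '' {w' | ord w' ≤ ord w}) → q ∈ N' := by
    intro o
    induction o using WellFoundedLT.induction with
    | ind o ih =>
      rintro w rfl q hqN hq
      have hset : {w' | ord w' ≤ ord w} = insert w {w' | ord w' < ord w} := by
        ext w'
        simp [le_iff_eq_or_lt, hord.eq_iff]
      rw [hset, Set.image_insert_eq, Submodule.mem_span_insert] at hq
      obtain ⟨a, l, hl, rfl⟩ := hq
      obtain ⟨q', hq', l', hl', hql⟩ := mem_leadIdeal.1
        (h w (mem_leadIdeal.2 ⟨_, hqN, -l, neg_mem hl, by abel⟩))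
      have hd : l' + l ∈ N' := by
        have hmem : l' + l ∈ N := by
          have : l' + l = (a • e w + l) - q' := by rw [← hql]; abel
          rw [this]
          exact sub_mem hqN (hN hq')
        obtain h0 | ⟨w', hw', hl''⟩ :=
          mem_span_image_Iic_of_mem_span_image e ord (add_mem hl' hl)
        · rw [h0]
          exact zero_mem _
        · exact ih _ hw' w' rfl _ hmem hl''
      rw [← hql, add_assoc]
      exact add_mem hq' hd
  intro q hq
  have hq' : q ∈ Submodule.span K (e '' Set.univ) := by
    rw [Set.image_univ, he]
    trivial
  obtain rfl | ⟨w, -, hw⟩ := mem_span_image_Iic_of_mem_span_image e ord hq'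
  · exact zero_mem _
  · exact key _ w rfl q hq hw

/-- Each of finitely many generators of the leading ideal is lifted to an element of `N`. -/
theorem exists_finite_leadIdeal_le [IsNoetherianRing K] (e : W → V) (ord : W → O)
    (N : Submodule K V) (w : W) :
    ∃ G : Set V, G.Finite ∧ G ⊆ N ∧ ∀ N' : Submodule K V, G ⊆ N' →
      leadIdeal e ord N w ≤ leadIdeal e ord N' w := by
  obtain ⟨s, hs⟩ := (isNoetherianRing_iff_ideal_fg K).1 ‹_› (leadIdeal e ord N w)
  have hmem : ∀ a : s, ∃ q ∈ N, ∃ l ∈ Submodule.span K (e '' {w' | ord w' < ord w}),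
      q + l = (a : K) • e w :=
    fun a => mem_leadIdeal.1 (hs ▸ Ideal.subset_span a.2)
  choose q hq l hl hql using hmem
  refine ⟨Set.range q, Set.finite_range q, Set.range_subset_iff.2 hq, fun N' hN' => ?_⟩
  rw [← hs, Ideal.span_le]
  exact fun a ha => mem_leadIdeal.2 ⟨_, hN' ⟨⟨a, ha⟩, rfl⟩, _, hl ⟨a, ha⟩, hql ⟨a, ha⟩⟩

/-- Applying `T` to a relation `q + l = a • e w` gives a relation of the same shape at `w'`. -/
theorem leadIdeal_le_of_linearMap {V' W' O' : Type*} [AddCommGroup V'] [Module K V']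
    [LinearOrder O'] {e : W → V} {ord : W → O} {e' : W' → V'} {ord' : W' → O'}
    {N : Submodule K V} {N' : Submodule K V'} (T : V →ₗ[K] V') (hN : ∀ q ∈ N, T q ∈ N')
    {w : W} {w' : W'} (hw : T (e w) = e' w')
    (hlt : ∀ x, ord x < ord w → ∃ y, ord' y < ord' w' ∧ T (e x) = e' y) :
    leadIdeal e ord N w ≤ leadIdeal e' ord' N' w' := by
  intro a ha
  obtain ⟨q, hq, l, hl, hql⟩ := mem_leadIdeal.1 ha
  refine mem_leadIdeal.2 ⟨T q, hN q hq, T l, ?_, by rw [← map_add, hql, map_smul, hw]⟩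
  have : Submodule.span K (e '' {x | ord x < ord w}) ≤
      (Submodule.span K (e' '' {y | ord' y < ord' w'})).comap T := by
    rw [Submodule.span_le]
    rintro _ ⟨x, hx, rfl⟩
    obtain ⟨y, hy, hxy⟩ := hlt x hx
    exact Submodule.subset_span ⟨y, hy, hxy.symm⟩
  exact this hl

end Span

/-! ### A criterion for a module to be noetherian -/

namespace CatModule

variable {C : Type*} [Category C] [StdObjects C] {K : Type u} [CommRing K] {A : CatAlgebra C K}

theorem Sub.map_mem_iff_of_iso {M : CatModule.{v} A} (N : M.Sub) {S T : C} (i : S ≅ T)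
    {q : M.functor.obj S} : M.functor.map i.hom q ∈ N.obj T ↔ q ∈ N.obj S := by
  refine ⟨fun h => ?_, N.map_mem _⟩
  have := N.map_mem i.inv h
  rwa [← ConcreteCategory.comp_apply, ← Functor.map_comp, Iso.hom_inv_id, CategoryTheory.Functor.map_id,
    ConcreteCategory.id_apply] at this

theorem Sub.le_of_std (hC : ∀ S : C, ∃ n : ℕ, Nonempty (S ≅ StdObjects.std n))
    {M : CatModule.{v} A} {N N' : M.Sub}
    (h : ∀ n : ℕ, N.obj (StdObjects.std n) ≤ N'.obj (StdObjects.std n)) (S : C) :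
    N.obj S ≤ N'.obj S := by
  obtain ⟨n, ⟨i⟩⟩ := hC S
  intro q hq
  exact (N'.map_mem_iff_of_iso i).1 (h n ((N.map_mem_iff_of_iso i).2 hq))

/-- If each `M_n` is spanned over `K` by a family indexed by a well-ordered set, and if these
families together are well-quasi-ordered by operators which preserve the submodules of `M` and
leading terms, then `M` is noetherian. -/
theorem noetherian_of_wellQuasiOrdered [IsNoetherianRing K]
    (hC : ∀ S : C, ∃ n : ℕ, Nonempty (S ≅ StdObjects.std n)) (M : CatModule.{v} A)
    {W O : ℕ → Type*} [∀ n, LinearOrder (O n)] [∀ n, WellFoundedLT (O n)]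
    (ord : ∀ n, W n → O n) (hord : ∀ n, Function.Injective (ord n))
    (e : ∀ n, W n → M.functor.obj (StdObjects.std n))
    (he : ∀ n, Submodule.span K (Set.range (e n)) = ⊤)
    (r : (Σ n, W n) → (Σ n, W n) → Prop) [IsPreorder _ r] (hr : WellQuasiOrdered r)
    (hT : ∀ x y, r x y → ∃ T : M.functor.obj (StdObjects.std x.1) →ₗ[K]
        M.functor.obj (StdObjects.std y.1),
      (∀ N : M.Sub, ∀ q ∈ N.obj _, T q ∈ N.obj _) ∧ T (e _ x.2) = e _ y.2 ∧
      ∀ w, ord _ w < ord _ x.2 → ∃ w', ord _ w' < ord _ y.2 ∧ T (e _ w) = e _ w') :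
    M.Noetherian := by
  intro N
  let res (N : M.Sub) (n : ℕ) : Submodule K (M.functor.obj (StdObjects.std n)) :=
    (N.obj _).restrictScalars K
  let I (N : M.Sub) (x : Σ n, W n) : Ideal K := leadIdeal (e x.1) (ord x.1) (res N x.1) x.2
  have hI : ∀ N x y, r x y → I N x ≤ I N y := fun N x y hxy => by
    obtain ⟨T, h₁, h₂, h₃⟩ := hT x y hxy
    exact leadIdeal_le_of_linearMap T (h₁ N) h₂ h₃
  obtain ⟨B, hB, hBr⟩ := (hr.and_eq_of_monotone (I N) (hI N)).exists_finite_basis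
  choose G hGfin hGN hG using fun x : Σ n, W n =>
    exists_finite_leadIdeal_le (e x.1) (ord x.1) (res N x.1) x.2
  refine ⟨⋃ x ∈ B, Sigma.mk x.1 '' G x, hB.biUnion fun x _ => (hGfin x).image _, ?_, ?_⟩
  · intro g hg
    obtain ⟨x, -, q, hq, rfl⟩ := Set.mem_iUnion₂.1 hg
    exact hGN x hq
  · intro N' hN' hGN' S
    refine le_antisymm (hN' S) (Sub.le_of_std hC (fun n => ?_) S)
    have : res N n ≤ res N' n := le_of_leadIdeal_le (hord n) (he n) (hN' _) fun w => by
      -- The basis element `b` divides `w` and has the same leading ideal for `N`; the lifts at `b`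
      -- lie in `N'`, and monotonicity for `N'` leads back to `w`.
      obtain ⟨b, hb, hbw, hbI⟩ := hBr ⟨n, w⟩
      calc I N ⟨n, w⟩ = I N b := hbI.symm
        _ ≤ I N' b := hG b (res N' b.1) fun q hq =>
            hGN' ⟨b.1, q⟩ (Set.mem_biUnion hb ⟨q, hq, rfl⟩)
        _ ≤ I N' ⟨n, w⟩ := hI N' _ _ hbw
    exact this

end CatModule

/-! ### Terms -/

theorem List.SublistForall₂.exists_orderEmbedding {α β : Type*} {r : α → β → Prop} {m n : ℕ}
    {f : Fin m → α} {g : Fin n → β} (h : List.SublistForall₂ r (List.ofFn f) (List.ofFn g)) :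
    ∃ ε : Fin m ↪o Fin n, ∀ j, r (f j) (g (ε j)) := by
  obtain ⟨l, hl, hlg⟩ := List.sublistForall₂_iff.1 h
  obtain ⟨φ, hφ⟩ := List.sublist_iff_exists_fin_orderEmbedding_get_eq.1 hlg
  obtain ⟨hlen, hl⟩ := List.forall₂_iff_get.1 hl
  rw [List.length_ofFn] at hlen
  refine ⟨(Fin.castOrderIso hlen).toOrderEmbedding.trans
    (φ.trans (Fin.castOrderIso List.length_ofFn).toOrderEmbedding), fun j => ?_⟩
  have h₁ := hl j (by simp) (by omega)
  have h₂ := hφ (Fin.cast hlen j)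
  simp only [List.get_eq_getElem, List.getElem_ofFn, Fin.val_cast] at h₁ h₂
  rw [h₂] at h₁
  exact h₁

/-- A formal product of a monomial in the variables `x_{i,j}`, for `i ∈ [c]` and `j ∈ [n]`, and the
image of one of the generators, which have degrees `d`, under an order-preserving injection. -/
structure PolyTerm (c : ℕ) {r : ℕ} (d : Fin r → ℕ) (n : ℕ) where
  gen : Fin r
  emb : Fin (d gen) ↪o Fin n
  exp : Fin n → Fin c → ℕ

namespace PolyTerm

variable {c r : ℕ} {d : Fin r → ℕ} {m n : ℕ}

open Classical in
/-- The letter of a term at the position `j`. -/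
noncomputable def letter (t : PolyTerm c d n) (j : Fin n) : Bool × (Fin c → ℕ) :=
  (decide (j ∈ Set.range t.emb), t.exp j)

theorem letter_fst (t : PolyTerm c d n) (j : Fin n) :
    (t.letter j).1 = true ↔ j ∈ Set.range t.emb := by
  simp only [letter, decide_eq_true_eq]

/-- The image of a term under an order-preserving injection, times a monomial. -/
noncomputable def push (ε : Fin m ↪o Fin n) (v : Fin n → Fin c → ℕ) (t : PolyTerm c d m) :
    PolyTerm c d n :=
  ⟨t.gen, t.emb.trans ε, v + Function.extend ε t.exp 0⟩

theorem letter_push (ε : Fin m ↪o Fin n) (v : Fin n → Fin c → ℕ) (t : PolyTerm c d m)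
    (j : Fin m) : (t.push ε v).letter (ε j) = ((t.letter j).1, v (ε j) + (t.letter j).2) := by
  refine Prod.ext (decide_eq_decide.2 (exists_congr fun _ => ε.injective.eq_iff)) ?_
  simp only [letter, push, Pi.add_apply, ε.injective.extend_apply]

theorem letter_push_of_notMem (ε : Fin m ↪o Fin n) (v : Fin n → Fin c → ℕ) (t : PolyTerm c d m)
    {j : Fin n} (hj : j ∉ Set.range ε) : (t.push ε v).letter j = (false, v j) := by
  refine Prod.ext (decide_eq_false ?_) ?_
  · rintro ⟨i, rfl⟩
    exact hj ⟨t.emb i, rfl⟩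
  · simp only [letter, push, Pi.add_apply, Function.extend_apply' _ _ _ hj, Pi.zero_apply,
      add_zero]

/-- The monomial order: generators are compared first, then letters, lexicographically. -/
noncomputable def ord (t : PolyTerm c d n) :
    Fin r ×ₗ Lex (Fin n → Bool ×ₗ Lex (Fin c → ℕ)) :=
  toLex (t.gen, toLex fun j => toLex ((t.letter j).1, toLex (t.letter j).2))

/-- The word determines the range of the injection, and an order embedding of `Fin k` is determined
by its range. -/
theorem ord_injective : Function.Injective (ord : PolyTerm c d n → _) := by
  rintro ⟨g, π, u⟩ ⟨g', π', u'⟩ h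
  simp only [ord, toLex_inj, Prod.mk.injEq, funext_iff (β := fun _ => Bool ×ₗ _)] at h
  obtain ⟨rfl, h⟩ := h
  have hw : ∀ j, (PolyTerm.mk g π u).letter j = (PolyTerm.mk g π' u').letter j := fun j =>
    Prod.ext (h j).1 (h j).2
  have hu : u = u' := funext fun j => congrArg Prod.snd (hw j)
  have hπ : π = π' := OrderEmbedding.range_inj.1 <| Set.ext fun j => by
    rw [← letter_fst ⟨g, π, u⟩, hw, letter_fst]
  rw [hu, hπ]

/-- If the words first differ at `j`, the pushed words first differ at `ε j`: off the range of `ε`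
both have the letter `(false, v)`. Adding `v` to both exponents preserves the lexicographic order.
-/
theorem ord_push_lt (ε : Fin m ↪o Fin n) (v : Fin n → Fin c → ℕ) {t t' : PolyTerm c d m}
    (h : t.ord < t'.ord) : (t.push ε v).ord < (t'.push ε v).ord := by
  rw [ord, ord, Prod.Lex.toLex_lt_toLex] at h ⊢
  refine h.imp id fun ⟨hg, j, hj, hlt⟩ => ⟨hg, ε j, fun i hi => ?_, ?_⟩
  · by_cases hi' : i ∈ Set.range ε
    · obtain ⟨i, rfl⟩ := hi'
      have := hj i (ε.lt_iff_lt.1 hi)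
      simp only [Pi.toLex_apply, toLex_inj, Prod.mk.injEq] at this
      simp only [Pi.toLex_apply, letter_push, this]
    · simp only [Pi.toLex_apply, letter_push_of_notMem ε v _ hi']
  · simp only [Pi.toLex_apply, letter_push, Prod.Lex.toLex_lt_toLex] at hlt ⊢
    refine hlt.imp id fun ⟨h₁, h₂⟩ => ⟨h₁, ?_⟩
    rw [toLex_add, toLex_add]
    exact add_lt_add_right h₂ _

/-- The order on letters. -/
def letterRel (c : ℕ) (a b : Bool × (Fin c → ℕ)) : Prop :=
  a.1 = b.1 ∧ a.2 ≤ b.2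

instance : IsPreorder _ (letterRel c) where
  refl _ := ⟨rfl, le_rfl⟩
  trans _ _ _ h h' := ⟨h.1.trans h'.1, h.2.trans h'.2⟩

/-- Dickson's lemma, with a finite factor for the mark. -/
theorem wellQuasiOrdered_letterRel : WellQuasiOrdered (letterRel c) :=
  (Finite.wellQuasiOrdered (· = ·)).prod wellQuasiOrdered_le

/-- The divisibility relation on terms. -/
def Divides (x y : Σ n, PolyTerm c d n) : Prop :=
  x.2.gen = y.2.gen ∧
    List.SublistForall₂ (letterRel c) (List.ofFn x.2.letter) (List.ofFn y.2.letter)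

instance : IsPreorder _ (Divides (c := c) (d := d)) where
  refl _ := ⟨rfl, refl _⟩
  trans _ _ _ h h' := ⟨h.1.trans h'.1, _root_.trans h.2 h'.2⟩

/-- Higman's lemma for words, with a finite factor for the generator. -/
theorem wellQuasiOrdered_divides : WellQuasiOrdered (Divides (c := c) (d := d)) := by
  have h := (Finite.wellQuasiOrdered (α := Fin r) (· = ·)).prod
    (Set.partiallyWellOrderedOn_univ_iff.1 <|
      (Set.PartiallyWellOrderedOn.partiallyWellOrderedOn_sublistForall₂ (letterRel c)
        (Set.partiallyWellOrderedOn_univ_iff.2 wellQuasiOrdered_letterRel)).mono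
        fun _ _ _ _ => Set.mem_univ _)
  intro f
  exact h fun n => ((f n).2.gen, List.ofFn (f n).2.letter)

theorem Divides.exists_push {x y : Σ n, PolyTerm c d n} (h : Divides x y) :
    ∃ (ε : Fin x.1 ↪o Fin y.1) (v : Fin y.1 → Fin c → ℕ), x.2.push ε v = y.2 := by
  obtain ⟨m, g, π, u⟩ := x
  obtain ⟨n, g', π', u'⟩ := y
  obtain ⟨hg, h⟩ := h
  obtain ⟨ε, hε⟩ := h.exists_orderEmbedding
  dsimp only at hg ε hε ⊢
  subst hg
  have hle : Function.extend ε u 0 ≤ u' := by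
    intro j
    by_cases hj : j ∈ Set.range ε
    · obtain ⟨i, rfl⟩ := hj
      rw [ε.injective.extend_apply]
      exact (hε i).2
    · rw [Function.extend_apply' _ _ _ hj]
      exact zero_le
  refine ⟨ε, u' - Function.extend ε u 0, ?_⟩
  have hπ : π.trans ε = π' := by
    rw [← OrderEmbedding.range_inj]
    -- Marked positions go to marked positions, and both words have `d g` marks, so no mark of `y`
    -- is missed.
    refine Set.eq_of_subset_of_ncard_le ?_ ?_ (Set.toFinite _)
    · rintro _ ⟨i, rfl⟩
      exact (letter_fst ⟨g, π', u'⟩ _).1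
        ((hε (π i)).1 ▸ (letter_fst ⟨g, π, u⟩ _).2 ⟨i, rfl⟩)
    · rw [← Set.image_univ, ← Set.image_univ,
        Set.ncard_image_of_injective _ π'.injective,
        Set.ncard_image_of_injective _ (π.trans ε).injective]
  rw [push, hπ, tsub_add_cancel_of_le hle]

end PolyTerm

/-! ### Categories of finite sets with order-preserving injections -/

/-- A category with objects `[0], [1], [2], …` up to isomorphism, in which order-preserving
injections `[m] → [n]` act, and each morphism `[m] ⟶ [n]` is an endomorphism of `[m]` followed by
such an injection. -/
class OrderedSkeleton (C : Type*) [Category C] [StdObjects C] where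
  exists_iso_std : ∀ S : C, ∃ n : ℕ, Nonempty (S ≅ StdObjects.std n)
  emb : ∀ {m n : ℕ}, (Fin m ↪o Fin n) → ((StdObjects.std m : C) ⟶ StdObjects.std n)
  emb_trans : ∀ {l m n : ℕ} (δ : Fin l ↪o Fin m) (ε : Fin m ↪o Fin n),
    emb (δ.trans ε) = emb δ ≫ emb ε
  finite_end : ∀ n : ℕ, Finite ((StdObjects.std n : C) ⟶ StdObjects.std n)
  subsingleton_end_one : Subsingleton ((StdObjects.std 1 : C) ⟶ StdObjects.std 1)
  exists_factor : ∀ {m n : ℕ} (f : (StdObjects.std m : C) ⟶ StdObjects.std n),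
    ∃ (τ : (StdObjects.std m : C) ⟶ StdObjects.std m) (π : Fin m ↪o Fin n), τ ≫ emb π = f

namespace OI

theorem exists_iso_std (S : OI) : ∃ n : ℕ, Nonempty (S ≅ StdObjects.std n) := by
  have := Fintype.ofFinite S
  let i : S ≃o Fin (Fintype.card S) := (Fintype.orderIsoFinOfCardEq S rfl).symm
  exact ⟨_, ⟨{
    hom := (i.toOrderEmbedding : S ↪o Fin _)
    inv := (i.symm.toOrderEmbedding : Fin _ ↪o S)
    hom_inv_id := RelEmbedding.ext i.symm_apply_apply
    inv_hom_id := RelEmbedding.ext i.apply_symm_apply }⟩⟩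

instance : OrderedSkeleton OI where
  exists_iso_std := exists_iso_std
  emb ε := ε
  emb_trans _ _ := rfl
  finite_end n := inferInstanceAs (Finite (Fin n ↪o Fin n))
  subsingleton_end_one := ⟨fun _ _ => RelEmbedding.ext fun _ => Subsingleton.elim (α := Fin 1) _ _⟩
  exists_factor f := ⟨𝟙 _, f, Category.id_comp _⟩

end OI

namespace FI

theorem exists_iso_std (S : FI) : ∃ n : ℕ, Nonempty (S ≅ StdObjects.std n) := by
  obtain ⟨n, ⟨i⟩⟩ := Finite.exists_equiv_fin S
  exact ⟨n, ⟨{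
    hom := (i.toEmbedding : S ↪ Fin n)
    inv := (i.symm.toEmbedding : Fin n ↪ S)
    hom_inv_id := Function.Embedding.ext i.symm_apply_apply
    inv_hom_id := Function.Embedding.ext i.apply_symm_apply }⟩⟩

theorem exists_factor {m n : ℕ} (f : Fin m ↪ Fin n) :
    ∃ (τ : Fin m ↪ Fin m) (π : Fin m ↪o Fin n), τ.trans π.toEmbedding = f := by
  -- `π` enumerates the image of `f` increasingly, and `τ` gives the rank of each value.
  let s : Finset (Fin n) := Finset.univ.map f
  let i : Fin m ≃o s := s.orderIsoOfFin (by simp [s])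
  have hf : ∀ x, f x ∈ s := fun x => Finset.mem_map_of_mem f (Finset.mem_univ x)
  refine ⟨⟨fun x => i.symm ⟨f x, hf x⟩, fun x y hxy => ?_⟩,
    i.toOrderEmbedding.trans (OrderEmbedding.subtype _), ?_⟩
  · exact f.injective (congrArg Subtype.val (i.symm.injective hxy))
  · ext x
    exact congrArg (fun y : s => (y : Fin n).1) (i.apply_symm_apply ⟨f x, hf x⟩)

instance : OrderedSkeleton FI where
  exists_iso_std := exists_iso_std
  emb ε := ε.toEmbedding
  emb_trans _ _ := rfl
  finite_end n := inferInstanceAs (Finite (Fin n ↪ Fin n))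
  subsingleton_end_one := ⟨fun _ _ => Function.Embedding.ext fun _ => Subsingleton.elim (α := Fin 1) _ _⟩
  exists_factor f := FI.exists_factor f

end FI

namespace OrderedSkeleton

variable (C : Type*) [Category C] [StdObjects C] [OrderedSkeleton C]

/-- The `j`-th point of `[n]`. -/
def point {n : ℕ} (j : Fin n) : (StdObjects.std 1 : C) ⟶ StdObjects.std n :=
  emb (OrderEmbedding.ofStrictMono (fun _ => j) (Subsingleton.strictMono _))

theorem point_comp_emb {m n : ℕ} (ε : Fin m ↪o Fin n) (j : Fin m) :
    point C j ≫ emb ε = point C (ε j) := by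
  rw [point, ← emb_trans]
  rfl

/-- The factor in `End [1]` is trivial. Hence the variables of `X^1` in degree `n` are indexed by
`[n]`. -/
theorem point_surjective {n : ℕ} : Function.Surjective (point C : Fin n → _) := by
  intro f
  obtain ⟨τ, π, rfl⟩ := exists_factor f
  have := subsingleton_end_one (C := C)
  refine ⟨π 0, ?_⟩
  rw [← point_comp_emb, Subsingleton.elim (point C 0) τ]

end OrderedSkeleton

/-! ### Modules over algebras generated by points -/

namespace CatModule

open OrderedSkeleton

variable {C : Type*} [Category C] [StdObjects C] {K : Type u} [CommRing K] {A : CatAlgebra C K}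

/-- The smallest submodule which contains `G`. -/
def span (M : CatModule.{v} A) (G : Set M.Elements) : M.Sub where
  obj S := Submodule.span _
    {q | ∃ g ∈ G, ∃ f : StdObjects.std g.1 ⟶ S, M.functor.map f g.2 = q}
  map_mem {S T} ε q hq := by
    induction hq using Submodule.span_induction with
    | mem x hx =>
      obtain ⟨g, hg, f, rfl⟩ := hx
      exact Submodule.subset_span ⟨g, hg, f ≫ ε, by simp⟩
    | zero => rw [map_zero]; exact zero_mem _
    | add x y _ _ hx hy => rw [map_add]; exact add_mem hx hy
    | smul a x _ hx =>
      have := M.map_smul (𝟙 S) ε a x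
      simp only [CategoryTheory.Functor.map_id, Category.id_comp] at this
      erw [this]
      exact Submodule.smul_mem _ _ hx

theorem span_eq_top {M : CatModule.{v} A} (hM : M.FinitelyGenerated) :
    ∃ G : Set M.Elements, G.Finite ∧ ∀ S, (M.span G).obj S = ⊤ := by
  obtain ⟨G, hG, -, h⟩ := hM
  refine ⟨G, hG, h (M.span G) (fun _ => le_top) fun g hg => ?_⟩
  exact Submodule.subset_span ⟨g, hg, 𝟙 _, by simp⟩

variable [OrderedSkeleton C]

/-- The monomial with exponents `u` in the elements `x i j` of `A_n`. -/
def monomial {c : ℕ} {R : Type*} [CommRing R] {n : ℕ} (x : Fin c → Fin n → R)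
    (u : Fin n → Fin c → ℕ) : R :=
  ∏ j, ∏ i, x i j ^ u j i

theorem monomial_add {c : ℕ} {R : Type*} [CommRing R] {n : ℕ} (x : Fin c → Fin n → R)
    (u v : Fin n → Fin c → ℕ) : monomial x (u + v) = monomial x u * monomial x v := by
  simp only [monomial, Pi.add_apply, pow_add, Finset.prod_mul_distrib]

theorem monomial_single {c : ℕ} {R : Type*} [CommRing R] {n : ℕ} (x : Fin c → Fin n → R)
    (i : Fin c) (j : Fin n) : monomial x (Pi.single j (Pi.single i 1)) = x i j := by
  rw [monomial, Finset.prod_eq_single j, Finset.prod_eq_single i]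
  · simp
  · intro b _ hb
    simp [hb]
  · simp
  · intro b _ hb
    simp [hb]
  · simp

theorem monomial_extend {c : ℕ} {R R' : Type*} [CommRing R] [CommRing R'] {m n : ℕ}
    {x : Fin c → Fin m → R} {y : Fin c → Fin n → R'} (φ : R →+* R') (ε : Fin m ↪o Fin n)
    (h : ∀ i j, φ (x i j) = y i (ε j)) (u : Fin m → Fin c → ℕ) :
    φ (monomial x u) = monomial y (Function.extend ε u 0) := by
  simp only [monomial, map_prod, map_pow, h]
  refine Fintype.prod_of_injective ε ε.injective _ _ (fun j hj => ?_) fun j => ?_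
  · simp [Function.extend_apply' _ _ _ hj]
  · simp [ε.injective.extend_apply]

section

variable (M : CatModule.{v} A) {c : ℕ} (x : ∀ n, Fin c → Fin n → A.functor.obj (StdObjects.std n))
  {r : ℕ} (g : Fin r → M.Elements)

/-- The element of `M` denoted by a term. -/
def termValue {n : ℕ} (t : PolyTerm c (fun k => (g k).1) n) :
    M.functor.obj (StdObjects.std n : C) :=
  monomial (x n) t.exp • M.functor.map (emb t.emb) (g t.gen).2

variable {x}

/-- Evaluation of terms turns the formal `push` into an operator on `M`. -/
theorem termValue_push
    (hx : ∀ {m n : ℕ} (ε : Fin m ↪o Fin n) i j, A.functor.map (emb ε) (x m i j) = x n i (ε j))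
    {m n : ℕ} (ε : Fin m ↪o Fin n) (v : Fin n → Fin c → ℕ)
    (t : PolyTerm c (fun k => (g k).1) m) :
    monomial (x n) v • M.functor.map (emb ε) (M.termValue x g t) =
      M.termValue x g (t.push ε v) := by
  have h := M.map_smul (𝟙 _) (emb ε) (monomial (x m) t.exp) (M.functor.map (emb t.emb) (g t.gen).2)
  have h' := monomial_extend (A.functor.map (emb ε)).hom.toRingHom ε (hx ε) t.exp
  simp only [CategoryTheory.Functor.map_id, Category.id_comp] at h
  rw [termValue, termValue]
  erw [h]
  simp only [PolyTerm.push, monomial_add, emb_trans, mul_smul, Functor.map_comp]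
  rw [← h']
  rfl

variable (x) in
-- Multiplication by `x_{i,j}` raises one exponent of a term, so the `K`-span of the terms is stable
-- under the algebra these elements generate.
theorem span_termValue {n : ℕ}
    (hx : ⊤ ≤ Algebra.adjoin K (Set.range fun p : Fin c × Fin n => x n p.1 p.2))
    (hg : Submodule.span (A.functor.obj (StdObjects.std n : C))
      (Set.range fun p : Σ k, Fin (g k).1 ↪o Fin n => M.functor.map (emb p.2) (g p.1).2) = ⊤) :
    Submodule.span K (Set.range (M.termValue x g (n := n))) = ⊤ := by
  have smul_mem : ∀ a : A.functor.obj (StdObjects.std n : C),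
      ∀ q ∈ Submodule.span K (Set.range (M.termValue x g (n := n))),
        a • q ∈ Submodule.span K (Set.range (M.termValue x g (n := n))) := by
    intro a
    induction hx (x := a) trivial using Algebra.adjoin_induction with
    | mem a ha =>
      obtain ⟨p, rfl⟩ := ha
      intro q hq
      induction hq using Submodule.span_induction with
      | mem q hq =>
        obtain ⟨t, rfl⟩ := hq
        refine Submodule.subset_span
          ⟨⟨t.gen, t.emb, Pi.single p.2 (Pi.single p.1 1) + t.exp⟩, ?_⟩
        simp only [termValue, monomial_add, monomial_single, mul_smul]
      | zero => rw [smul_zero]; exact zero_mem _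
      | add q q' _ _ h h' => rw [smul_add]; exact add_mem h h'
      | smul k q _ h => rw [smul_comm]; exact Submodule.smul_mem _ _ h
    | algebraMap k =>
      intro q hq
      rw [algebraMap_smul]
      exact Submodule.smul_mem _ _ hq
    | add a b _ _ ha hb =>
      intro q hq
      rw [add_smul]
      exact add_mem (ha q hq) (hb q hq)
    | mul a b _ _ ha hb =>
      intro q hq
      rw [mul_smul]
      exact ha _ (hb q hq)
  rw [eq_top_iff]
  intro q _
  have hq : q ∈ Submodule.span (A.functor.obj (StdObjects.std n : C))
      (Set.range fun p : Σ k, Fin (g k).1 ↪o Fin n => M.functor.map (emb p.2) (g p.1).2) :=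
    hg ▸ Submodule.mem_top
  induction hq using Submodule.span_induction with
  | mem q hq =>
    obtain ⟨p, rfl⟩ := hq
    exact Submodule.subset_span ⟨⟨p.1, p.2, 0⟩, by simp [termValue, monomial]⟩
  | zero => exact zero_mem _
  | add q q' _ _ h h' => exact add_mem (h trivial) (h' trivial)
  | smul a q _ h => exact smul_mem a q (h trivial)

end

theorem exists_span_emb_eq_top {M : CatModule.{v} A} (hM : M.FinitelyGenerated) :
    ∃ (r : ℕ) (g : Fin r → M.Elements), ∀ n, Submodule.span (A.functor.obj (StdObjects.std n : C))
      (Set.range fun p : Σ k, Fin (g k).1 ↪o Fin n => M.functor.map (emb p.2) (g p.1).2) = ⊤ := by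
  obtain ⟨G, hG, h⟩ := span_eq_top hM
  let G' : Set M.Elements := ⋃ q ∈ G,
    Set.range fun τ : StdObjects.std q.1 ⟶ StdObjects.std q.1 => ⟨q.1, M.functor.map τ q.2⟩
  have hG' : G'.Finite := hG.biUnion fun q _ =>
    have := finite_end (C := C) q.1
    Set.finite_range _
  have := hG'.to_subtype
  obtain ⟨r, ⟨i⟩⟩ := Finite.exists_equiv_fin G'
  refine ⟨r, fun k => (i.symm k).1, fun n => ?_⟩
  rw [eq_top_iff, ← h, span, Submodule.span_le]
  rintro _ ⟨q, hq, f, rfl⟩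
  obtain ⟨τ, π, rfl⟩ := exists_factor f
  have hmem : (⟨q.1, M.functor.map τ q.2⟩ : M.Elements) ∈ G' :=
    Set.mem_biUnion hq ⟨τ, rfl⟩
  obtain ⟨k, hk⟩ := i.symm.surjective ⟨_, hmem⟩
  -- The type of `π` depends on the degree of the generator, so `π` is generalised along with it.
  have : ∀ (y : M.Elements) (hy : (i.symm k).1 = y) (π : Fin y.1 ↪o Fin n),
      M.functor.map (emb π) y.2 ∈ Set.range fun p : Σ k, Fin (i.symm k).1.1 ↪o Fin n =>
        M.functor.map (emb p.2) (i.symm p.1).1.2 := by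
    rintro _ rfl π
    exact ⟨⟨k, π⟩, rfl⟩
  refine Submodule.subset_span ?_
  simpa using this _ (congrArg Subtype.val hk) π

/-- A finitely generated module over an algebra which is generated by the images of finitely many
elements of degree one is noetherian. -/
theorem FinitelyGenerated.noetherian [IsNoetherianRing K] {M : CatModule.{v} A}
    (hM : M.FinitelyGenerated) {c : ℕ}
    (x : ∀ n, Fin c → Fin n → A.functor.obj (StdObjects.std n))
    (hxA : ∀ n, ⊤ ≤ Algebra.adjoin K (Set.range fun p : Fin c × Fin n => x n p.1 p.2))
    (hx : ∀ {m n : ℕ} (ε : Fin m ↪o Fin n) i j,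
      A.functor.map (emb ε) (x m i j) = x n i (ε j)) : M.Noetherian := by
  obtain ⟨r, g, hg⟩ := exists_span_emb_eq_top hM
  refine noetherian_of_wellQuasiOrdered exists_iso_std M (fun _ => PolyTerm.ord)
    (fun _ => PolyTerm.ord_injective) (fun _ => M.termValue x g)
    (fun n => M.span_termValue x g (hxA n) (hg n)) PolyTerm.Divides
    PolyTerm.wellQuasiOrdered_divides fun y z hyz => ?_
  obtain ⟨ε, v, h⟩ := hyz.exists_push
  refine ⟨Algebra.lsmul K K _ (monomial (x z.1) v) ∘ₗ (M.functor.map (emb ε)).hom,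
    fun N q hq => Submodule.smul_mem _ _ (N.map_mem _ hq), ?_, fun w hw => ⟨w.push ε v, ?_, ?_⟩⟩
  · rw [← h]
    exact M.termValue_push g hx ε v y.2
  · rw [← h]
    exact PolyTerm.ord_push_lt ε v hw
  · exact M.termValue_push g hx ε v w

end CatModule

/-! ### Tensor powers of polynomial rings -/

namespace MvPolynomial

variable {K : Type u} [CommRing K] {ι σ τ : Type} [DecidableEq ι]

variable (K ι σ) in
/-- The `i`-th inclusion of the polynomial ring in the variables `x_s` into its tensor power. -/
noncomputable abbrev tensorSingle (i : ι) : MvPolynomial σ K →ₐ[K] ⨂[K] _ : ι, MvPolynomial σ K :=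
  PiTensorProduct.singleAlgHom (R := K) (A := fun _ : ι => MvPolynomial σ K) i

variable (K ι σ) in
/-- The algebra homomorphism from the polynomial ring in the variables `x_{i,s}` to the tensor power
of the polynomial ring in the variables `x_s`. -/
noncomputable def toTensorPow : MvPolynomial (ι × σ) K →ₐ[K] ⨂[K] _ : ι, MvPolynomial σ K :=
  aeval fun p => tensorSingle K ι σ p.1
    (X p.2)

theorem toTensorPow_X (p : ι × σ) : toTensorPow K ι σ (X p) =
    tensorSingle K ι σ p.1 (X p.2) :=
  aeval_X _ _

theorem tensorMap_single (f : MvPolynomial σ K →ₐ[K] MvPolynomial τ K) (i : ι)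
    (p : MvPolynomial σ K) :
    CatAlgebra.tensorMap (fun _ : ι => f)
        (tensorSingle K ι σ i p) =
      tensorSingle K ι τ i (f p) := by
  rw [PiTensorProduct.singleAlgHom_apply, PiTensorProduct.singleAlgHom_apply,
    CatAlgebra.tensorMap_tprod]
  congr 1
  ext1 j
  by_cases h : j = i
  · subst h
    simp
  · simp [h]

/-- This is the naturality needed to compare `polyP` with the tensor power. -/
theorem tensorMap_toTensorPow (f : σ → τ) (p : MvPolynomial (ι × σ) K) :
    CatAlgebra.tensorMap (fun _ : ι => rename (R := K) f) (toTensorPow K ι σ p) =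
      toTensorPow K ι τ (rename (fun q => (q.1, f q.2)) p) := by
  have : (CatAlgebra.tensorMap fun _ : ι => rename (R := K) f).comp (toTensorPow K ι σ) =
      (toTensorPow K ι τ).comp (rename fun q : ι × σ => (q.1, f q.2)) :=
    algHom_ext fun q => by
      simp only [AlgHom.comp_apply, toTensorPow_X, tensorMap_single, rename_X]
  exact DFunLike.congr_fun this p

variable [Fintype ι]

variable (K ι σ) in
/-- The inverse of `MvPolynomial.toTensorPow`. -/
noncomputable def ofTensorPow : (⨂[K] _ : ι, MvPolynomial σ K) →ₐ[K] MvPolynomial (ι × σ) K :=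
  PiTensorProduct.liftAlgHom
    ((MultilinearMap.mkPiAlgebra K ι (MvPolynomial (ι × σ) K)).compLinearMap fun i =>
      (rename fun s => (i, s)).toLinearMap)
    (by simp) (fun x y => by simp [Finset.prod_mul_distrib])

theorem ofTensorPow_single (i : ι) (p : MvPolynomial σ K) :
    ofTensorPow K ι σ (tensorSingle K ι σ i p) =
      rename (fun s => (i, s)) p := by
  rw [ofTensorPow, PiTensorProduct.singleAlgHom_apply]
  erw [PiTensorProduct.liftAlgHom_apply]
  rw [PiTensorProduct.lift.tprod, MultilinearMap.compLinearMap_apply,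
    MultilinearMap.mkPiAlgebra_apply, Finset.prod_eq_single i]
  · simp
  · intro j _ hj
    simp [hj]
  · simp

variable (K ι σ) in
/-- Tensor powers of polynomial rings are polynomial rings. -/
noncomputable def tensorPowEquiv :
    MvPolynomial (ι × σ) K ≃ₐ[K] ⨂[K] _ : ι, MvPolynomial σ K :=
  AlgEquiv.ofAlgHom (toTensorPow K ι σ) (ofTensorPow K ι σ)
    (PiTensorProduct.algHom_ext fun i => algHom_ext fun s => by
      simp only [AlgHom.comp_apply, ofTensorPow_single, rename_X, toTensorPow_X]
      rfl)
    (algHom_ext fun p => by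
      simp only [AlgHom.comp_apply, ofTensorPow_single, rename_X, toTensorPow_X]
      rfl)

theorem adjoin_single_X :
    ⊤ ≤ Algebra.adjoin K (Set.range fun p : ι × σ => tensorSingle K ι σ p.1 (X p.2)) := by
  rw [Algebra.adjoin_range_eq_range_aeval]
  intro q _
  exact (tensorPowEquiv K ι σ).surjective q

end MvPolynomial

open MvPolynomial

/-- The `FI^O`-algebra `P` is the tensor power of `X^{O,1}`. -/
theorem nonempty_polyP_iso (K : Type u) [CommRing K] (c : ℕ) :
    Nonempty ((polyP K c).functor ≅ ((XO K 1).tensorPow c).functor) := by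
  -- A morphism `[1] ⟶ S` is a point of `S`, which matches the two sets of variables.
  let pt (S : OI) : S ≃ ((StdObjects.std 1 : OI) ⟶ S) :=
    { toFun := fun s => (OrderEmbedding.ofStrictMono (fun _ => s) (Subsingleton.strictMono _) :
        Fin 1 ↪o S)
      invFun := fun f : Fin 1 ↪o S => f 0
      left_inv := fun _ => rfl
      right_inv := fun (f : Fin 1 ↪o S) => RelEmbedding.ext fun x : Fin 1 =>
        congrArg f (Subsingleton.elim 0 x) }
  refine ⟨NatIso.ofComponents (fun S => CommAlgCat.isoMk
    ((renameEquiv K ((Equiv.refl (Fin c)).prodCongr (pt S))).trans (tensorPowEquiv _ _ _)))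
    fun {S T} ε => ?_⟩
  ext1
  refine algHom_ext fun p => ?_
  have h := tensorMap_toTensorPow (K := K) (ι := Fin c)
    (fun π : (StdObjects.std 1 : OI) ⟶ S => π ≫ ε) (X (p.1, pt S p.2))
  rw [rename_X] at h
  change toTensorPow K (Fin c) ((StdObjects.std 1 : OI) ⟶ T) (rename _ (rename _ (X p))) =
    CatAlgebra.tensorMap (fun _ : Fin c => rename (R := K) fun π => π ≫ ε)
      (toTensorPow K (Fin c) ((StdObjects.std 1 : OI) ⟶ S) (rename _ (X p)))
  simp only [rename_X]
  exact h.symm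

namespace CatModule

open OrderedSkeleton

/-- A finitely generated module over a tensor power of `X^1` is noetherian. -/
theorem FinitelyGenerated.noetherian_of_iso {C : Type*} [Category.{0} C] [StdObjects C]
    [OrderedSkeleton C] {K : Type u} [CommRing K] [IsNoetherianRing K] {c : ℕ} {A : CatAlgebra C K}
    (i : A.functor ≅ ((CatAlgebra.poly C K 1).tensorPow c).functor) {M : CatModule.{v} A}
    (hM : M.FinitelyGenerated) : M.Noetherian := by
  -- `y n k j` is the variable of the point `j` in the `k`-th tensor factor; `i.inv` carries it to
  -- `A`.
  let y (n : ℕ) (k : Fin c) (j : Fin n) :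
      ((CatAlgebra.poly C K 1).tensorPow c).functor.obj (StdObjects.std n) :=
    tensorSingle K (Fin c) ((StdObjects.std 1 : C) ⟶ StdObjects.std n) k
      (X (point C j))
  refine hM.noetherian (fun n k j => i.inv.app _ (y n k j)) (fun n => ?_) fun {m n} ε k j => ?_
  · have hy : Algebra.adjoin K (Set.range fun p : Fin c × Fin n => y n p.1 p.2) = ⊤ := by
      refine eq_top_iff.2 (adjoin_single_X.trans (Algebra.adjoin_mono ?_))
      rintro _ ⟨⟨k, f⟩, rfl⟩
      obtain ⟨j, rfl⟩ := point_surjective C f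
      exact ⟨(k, j), rfl⟩
    have h := congrArg (Subalgebra.map (i.inv.app (StdObjects.std n)).hom) hy
    rw [AlgHom.map_adjoin, ← Set.range_comp, Algebra.map_top] at h
    refine (Eq.trans ?_ h.symm).le
    symm
    rw [AlgHom.range_eq_top]
    intro a
    refine ⟨i.hom.app _ a, ?_⟩
    exact congrArg (fun f => f.hom a) (i.hom_inv_id_app (StdObjects.std n))
  · have h := congrArg (fun f => f.hom (y m k j)) (i.inv.naturality (emb ε))
    refine h.symm.trans (congrArg (i.inv.app _).hom ?_)
    refine (tensorMap_single (rename fun π => π ≫ emb ε) k (X (point C j))).trans ?_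
    rw [rename_X, point_comp_emb]

end CatModule

theorem mainTheorem1 {K : Type u} [CommRing K] [IsNoetherianRing K] (c : ℕ) (hc : 0 < c) :
    (Nonempty ((polyP K c).functor ≅ ((XO K 1).tensorPow c).functor) ∧
      ∀ A : OIAlgebra K, Nonempty (A.functor ≅ ((XO K 1).tensorPow c).functor) →
        ∀ M : OIModule.{v} A, M.FinitelyGenerated → M.Noetherian) ∧
    (∀ A : FIAlgebra K, Nonempty (A.functor ≅ ((XI K 1).tensorPow c).functor) →
        ∀ M : FIModule.{v} A, M.FinitelyGenerated → M.Noetherian) :=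
  ⟨⟨nonempty_polyP_iso K c, fun _ ⟨i⟩ _ hM => hM.noetherian_of_iso i⟩,
    fun _ ⟨i⟩ _ hM => hM.noetherian_of_iso i⟩
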